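/- Let $m\ge 0$, let $\mathbb R^m$ carry its standard inner product, and let $K\subset\mathbb R^m$ be a closed convex cone (nonempty, closed under addition and under multiplication by nonnegative scalars) with dual $K^*=\{y:\langle x,y\rangle\ge 0\ \ \forall x\in K\}$. For a nonempty closed convex set $D$ let $P_D$ denote the metric (nearest point) projection onto $D$. Define $$x\sqcap y=P_{x-K}\,y,\qquad x\sqcup y=P_{x+K}\,y,\qquad x\sqcap_* y=P_{x-K^*}\,y,\qquad x\sqcup_* y=P_{x+K^*}\,y ,$$ and call a set $M\subset\mathbb R^m$ $K$-invariant if $x,y\in M$ implies that $x\sqcap y$, $x\sqcup y$, $x\sqcap_* y$ and $x\sqcup_* y$ all lie in $M$. For $u\neq 0$ and $a\in\mathbb R^m$ put $H(u,a)=\{x:\langle u,x\rangle=\langle u,a\rangle\}$ and $H_-(u,a)=\{x:\langle u,x\rangle\le\langle u,a\rangle\}$. A hyperplane $H$ is a supporting hyperplane of $C$ at $x\in C$ if $x\in H$ and $C$ lies in one of the two closed halfspaces bounded by $H$; it is tangent to $C$ if for some $x\in C$ it is the unique supporting hyperplane of $C$ at $x$. Let $C\subset\mathbb R^m$ be a closed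 convex set with nonempty interior. Then $C$ is $K$-invariant if and only if there are a countable (possibly empty) index set $I\subset\mathbb N$ and vectors $u_i\neq 0$, $a_i\in\mathbb R^m$ $(i\in I)$ such that $$C=\bigcap_{i\in I}H_-(u_i,a_i)$$ (the empty intersection being $\mathbb R^m$) and each hyperplane $H(u_i,a_i)$, $i\in I$, is tangent to $C$ and is $K$-invariant. -/

import Mathlib

noncomputable section

namespace LatticeLike

/-- `m`-dimensional Euclidean space with its standard inner product. -/
abbrev E (m : ℕ) : Type := EuclideanSpace ℝ (Fin m)

variable {m : ℕ}

/-- The metric projection `P_D`: `P_D x` is the point of `D` nearest to `x`, which exists and is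
unique when `D` is a nonempty closed convex set (see `metricProj_spec`, `eq_metricProj`). -/
def metricProj (D : Set (E m)) (x : E m) : E m :=
  Classical.epsilon fun p => p ∈ D ∧ ‖x - p‖ = ⨅ y : D, ‖x - y‖

theorem metricProj_spec {D : Set (E m)} (hne : D.Nonempty) (hcl : IsClosed D)
    (hcv : Convex ℝ D) (x : E m) :
    metricProj D x ∈ D ∧ ‖x - metricProj D x‖ = ⨅ y : D, ‖x - y‖ :=
  Classical.epsilon_spec (p := fun p => p ∈ D ∧ ‖x - p‖ = ⨅ y : D, ‖x - y‖)
    (exists_norm_eq_iInf_of_complete_convex hne hcl.isComplete hcv x)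

theorem eq_metricProj {D : Set (E m)} (hcl : IsClosed D) (hcv : Convex ℝ D) {x p : E m}
    (hp : p ∈ D) (h : ‖x - p‖ = ⨅ y : D, ‖x - y‖) : p = metricProj D x := by
  obtain ⟨hq, hq'⟩ := metricProj_spec ⟨p, hp⟩ hcl hcv x
  have h1 := (norm_eq_iInf_iff_real_inner_le_zero hcv hp).1 h _ hq
  have h2 := (norm_eq_iInf_iff_real_inner_le_zero hcv hq).1 hq' _ hp
  have h3 : inner ℝ (p - metricProj D x) (p - metricProj D x) ≤ 0 := by
    have e : inner ℝ (p - metricProj D x) (p - metricProj D x)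
        = inner ℝ (x - p) (metricProj D x - p)
          + inner ℝ (x - metricProj D x) (p - metricProj D x) := by
      rw [← neg_sub p (metricProj D x), inner_neg_right, neg_add_eq_sub, ← inner_sub_left]
      congr 1
      abel
    linarith
  rw [real_inner_self_eq_norm_sq] at h3
  exact sub_eq_zero.1 (norm_eq_zero.1 (pow_eq_zero_iff two_ne_zero |>.1 (le_antisymm h3 (sq_nonneg _))))

/-- The dual cone `K^* = {y | ∀ x ∈ K, 0 ≤ ⟨x, y⟩}`. -/
def dualCone (K : ProperCone ℝ (E m)) : ProperCone ℝ (E m) :=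
  ProperCone.innerDual (K : Set (E m))

/-- `x ⊓ y = P_{x - K} y`. -/
def coneInf (K : ProperCone ℝ (E m)) (x y : E m) : E m :=
  metricProj ((fun k => x - k) '' (K : Set (E m))) y

/-- `x ⊔ y = P_{x + K} y`. -/
def coneSup (K : ProperCone ℝ (E m)) (x y : E m) : E m :=
  metricProj ((fun k => x + k) '' (K : Set (E m))) y

/-- `M` is invariant with respect to the binary operation `op`. -/
def InvariantUnder (op : E m → E m → E m) (M : Set (E m)) : Prop :=
  ∀ x ∈ M, ∀ y ∈ M, op x y ∈ M

/-- `M` is `K`-invariant: it is invariant with respect to the four lattice-like operations given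
by `K` and by its dual cone. -/
structure IsInvariant (K : ProperCone ℝ (E m)) (M : Set (E m)) : Prop where
  inf : InvariantUnder (coneInf K) M
  sup : InvariantUnder (coneSup K) M
  inf_dual : InvariantUnder (coneInf (dualCone K)) M
  sup_dual : InvariantUnder (coneSup (dualCone K)) M

/-- `H(u, a)`, a hyperplane through `a` when `u ≠ 0`. -/
def hyperplane (u a : E m) : Set (E m) := {x | inner ℝ u x = inner ℝ u a}

/-- `H_-(u, a)`, a closed halfspace bounded by `H(u, a)` when `u ≠ 0`. -/
def lowerHalfspace (u a : E m) : Set (E m) := {x | inner ℝ u x ≤ inner ℝ u a}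

/-- `H` is a supporting hyperplane of `C` at the point `x` of `C`. Replacing `u` by `-u`
interchanges the two halfspaces, so that using only `H_-` is no restriction. -/
def IsSupportingAt (C H : Set (E m)) (x : E m) : Prop :=
  x ∈ C ∧ ∃ u : E m, u ≠ 0 ∧ H = hyperplane u x ∧ C ⊆ lowerHalfspace u x

/-- `H` is tangent to `C`: at some point of `C`, it is the unique supporting hyperplane of `C`. -/
def IsTangent (C H : Set (E m)) : Prop :=
  ∃ x, IsSupportingAt C H x ∧ ∀ H', IsSupportingAt C H' x → H' = H

end LatticeLike

end

open Metric Filter Topology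

namespace LatticeLike

variable {m : ℕ}

/-! Write `P` for the projection onto `K`. The operations are `x ⊔ y = x + P (y - x)` and `x ⊓ y = x
- P (x - y)`, and by Moreau's decomposition the dual operations are these two with arguments
swapped. A hyperplane with normal `u` is therefore invariant iff `P` preserves `uᗮ`. If it is,
nonexpansiveness makes its halfspaces invariant (`inner_coneProj_mem_Icc`), and so are their
intersections. Conversely, at a point of tangency the directions into `C` include the whole open
halfspace (`exists_pos_add_smul_mem`). As `P` is positively homogeneous, invariance of `C` passes in
the limit to the tangent hyperplane (`IsTangent.isInvariant`). Tangent hyperplanes separate `C` from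
every outside point (`exists_isTangent_separating`), and the Lindelöf property selects countably
many. -/

theorem metricProj_eq_of_inner_le {D : Set (E m)} (hcl : IsClosed D) (hcv : Convex ℝ D)
    {x p : E m} (hp : p ∈ D) (h : ∀ w ∈ D, inner ℝ (x - p) (w - p) ≤ 0) :
    metricProj D x = p :=
  (eq_metricProj hcl hcv hp ((norm_eq_iInf_iff_real_inner_le_zero hcv hp).2 h)).symm

/-- The metric projection onto the cone `K`. -/
noncomputable def coneProj (K : ProperCone ℝ (E m)) (z : E m) : E m :=
  metricProj (K : Set (E m)) z

/-! ### Projection onto a cone; invariant hyperplanes and halfspaces. -/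

section ConeProj

variable (K : ProperCone ℝ (E m))

theorem convex_cone : Convex ℝ (K : Set (E m)) := by
  intro x hx y hy a b ha hb _
  exact K.add_mem (K.smul_mem hx ha) (K.smul_mem hy hb)

theorem coneProj_mem (z : E m) : coneProj K z ∈ K :=
  (metricProj_spec ⟨0, K.zero_mem⟩ K.isClosed (convex_cone K) z).1

theorem inner_sub_coneProj_le (z : E m) {k : E m} (hk : k ∈ K) :
    inner ℝ (z - coneProj K z) (k - coneProj K z) ≤ 0 :=
  (norm_eq_iInf_iff_real_inner_le_zero (convex_cone K) (coneProj_mem K z)).1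
    (metricProj_spec ⟨0, K.zero_mem⟩ K.isClosed (convex_cone K) z).2 k hk

theorem coneProj_eq {z p : E m} (hp : p ∈ K) (h : ∀ k ∈ K, inner ℝ (z - p) (k - p) ≤ 0) :
    coneProj K z = p :=
  metricProj_eq_of_inner_le K.isClosed (convex_cone K) hp h

theorem inner_sub_coneProj_nonpos (z : E m) {k : E m} (hk : k ∈ K) :
    inner ℝ (z - coneProj K z) k ≤ 0 := by
  simpa using inner_sub_coneProj_le K z (K.add_mem hk (coneProj_mem K z))

theorem inner_sub_coneProj_self (z : E m) :
    inner ℝ (z - coneProj K z) (coneProj K z) = 0 := by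
  refine le_antisymm (inner_sub_coneProj_nonpos K z (coneProj_mem K z)) ?_
  simpa using inner_sub_coneProj_le K z K.zero_mem

/-- Moreau's decomposition. -/
theorem coneProj_dualCone (z : E m) : coneProj (dualCone K) z = z + coneProj K (-z) := by
  have h0 := inner_sub_coneProj_self K (-z)
  have h1 : -z - coneProj K (-z) = -(z + coneProj K (-z)) := by abel
  rw [h1, inner_neg_left, neg_eq_zero] at h0
  apply coneProj_eq
  · refine ProperCone.mem_innerDual.2 fun k hk => ?_
    have := inner_sub_coneProj_nonpos K (-z) hk
    rw [h1, inner_neg_left, real_inner_comm] at this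
    linarith
  · intro w hw
    have hw' : 0 ≤ inner ℝ (coneProj K (-z)) w :=
      ProperCone.mem_innerDual.1 hw (coneProj_mem K (-z))
    have h2 : z - (z + coneProj K (-z)) = -coneProj K (-z) := by abel
    rw [h2, inner_neg_left, inner_sub_right, real_inner_comm (z + coneProj K (-z)), h0]
    linarith

theorem coneProj_smul {t : ℝ} (ht : 0 < t) (z : E m) :
    coneProj K (t • z) = t • coneProj K z := by
  refine coneProj_eq K (K.smul_mem (coneProj_mem K z) ht.le) fun k hk => ?_
  have h := inner_sub_coneProj_nonpos K z hk
  have h' := inner_sub_coneProj_self K z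
  rw [← smul_sub, inner_smul_left, inner_sub_right, inner_smul_right, h']
  simpa using mul_nonpos_of_nonneg_of_nonpos ht.le h

/-- The projection onto a cone is firmly nonexpansive. -/
theorem norm_coneProj_sub_sq_le (z w : E m) :
    ‖coneProj K z - coneProj K w‖ ^ 2 ≤ inner ℝ (coneProj K z - coneProj K w) (z - w) := by
  have h1 := inner_sub_coneProj_le K z (coneProj_mem K w)
  have h2 := inner_sub_coneProj_le K w (coneProj_mem K z)
  rw [← real_inner_self_eq_norm_sq]
  simp only [inner_sub_left, inner_sub_right, real_inner_comm] at h1 h2 ⊢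
  linarith [real_inner_comm z (coneProj K z), real_inner_comm w (coneProj K z),
    real_inner_comm z (coneProj K w), real_inner_comm w (coneProj K w),
    real_inner_comm (coneProj K w) (coneProj K z)]

theorem norm_coneProj_sub_le (z w : E m) : ‖coneProj K z - coneProj K w‖ ≤ ‖z - w‖ := by
  have h := (norm_coneProj_sub_sq_le K z w).trans (real_inner_le_norm _ _)
  rcases (norm_nonneg (coneProj K z - coneProj K w)).eq_or_lt with h0 | h0
  · rw [← h0]; positivity
  · rw [sq] at h
    exact le_of_mul_le_mul_left h h0

theorem continuous_coneProj : Continuous (coneProj K) :=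
  (LipschitzWith.of_dist_le_mul (K := 1) fun z w => by
    simpa [dist_eq_norm] using norm_coneProj_sub_le K z w).continuous

theorem coneSup_eq (x y : E m) : coneSup K x y = x + coneProj K (y - x) := by
  refine metricProj_eq_of_inner_le ?_ ?_ ⟨_, coneProj_mem K _, rfl⟩ ?_
  · exact (Homeomorph.addLeft x).isClosedMap _ K.isClosed
  · exact (convex_cone K).translate x
  · rintro _ ⟨k, hk, rfl⟩
    simpa [sub_sub] using inner_sub_coneProj_le K (y - x) hk

theorem coneInf_eq (x y : E m) : coneInf K x y = x - coneProj K (x - y) := by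
  refine metricProj_eq_of_inner_le ?_ ?_ ⟨_, coneProj_mem K _, rfl⟩ ?_
  · exact (Homeomorph.subLeft x).isClosedMap _ K.isClosed
  · have h := ((convex_cone K).neg).translate x
    rwa [← Set.image_neg_eq_neg, Set.image_image] at h
  · rintro _ ⟨k, hk, rfl⟩
    have h := inner_sub_coneProj_le K (x - y) hk
    have e1 : y - (x - coneProj K (x - y)) = -(x - y - coneProj K (x - y)) := by abel
    have e2 : x - k - (x - coneProj K (x - y)) = -(k - coneProj K (x - y)) := by abel
    change inner ℝ (y - (x - coneProj K (x - y))) (x - k - (x - coneProj K (x - y))) ≤ 0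
    rwa [e1, e2, inner_neg_neg]

/-- By Moreau, `x ⊓_* y = y ⊓ x` and `x ⊔_* y = y ⊔ x`, so the dual operations impose nothing new.
-/
theorem isInvariant_iff {M : Set (E m)} :
    IsInvariant K M ↔
      ∀ x ∈ M, ∀ y ∈ M, x + coneProj K (y - x) ∈ M ∧ x - coneProj K (x - y) ∈ M := by
  constructor
  · intro h x hx y hy
    rw [← coneSup_eq, ← coneInf_eq]
    exact ⟨h.sup x hx y hy, h.inf x hx y hy⟩
  · intro h
    refine ⟨fun x hx y hy => ?_, fun x hx y hy => ?_, fun x hx y hy => ?_, fun x hx y hy => ?_⟩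
    · rw [coneInf_eq]; exact (h x hx y hy).2
    · rw [coneSup_eq]; exact (h x hx y hy).1
    · rw [coneInf_eq, coneProj_dualCone, neg_sub]
      convert (h y hy x hx).2 using 1
      abel
    · rw [coneSup_eq, coneProj_dualCone, neg_sub]
      convert (h y hy x hx).1 using 1
      abel

theorem isInvariant_hyperplane_iff (u a : E m) :
    IsInvariant K (hyperplane u a) ↔ ∀ z, inner ℝ u z = 0 → inner ℝ u (coneProj K z) = 0 := by
  rw [isInvariant_iff]
  constructor
  · intro h z hz
    have := (h a rfl (a + z) (by simp [hyperplane, inner_add_right, hz])).1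
    simpa [hyperplane, inner_add_right] using this
  · intro h x hx y hy
    simp only [hyperplane, Set.mem_ofPred_eq] at hx hy ⊢
    have h1 := h (y - x) (by rw [inner_sub_right, hx, hy, sub_self])
    have h2 := h (x - y) (by rw [inner_sub_right, hx, hy, sub_self])
    rw [inner_add_right, inner_sub_right, h1, h2, hx]
    simp

/-- Compare `z` with its orthogonal projection `w` on `uᗮ`, whose cone projection stays in `uᗮ`.
Firm nonexpansiveness gives the lower bound, Cauchy–Schwarz with nonexpansiveness the upper one. -/
theorem inner_coneProj_mem_Icc {u : E m} (hu : u ≠ 0)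
    (h : ∀ z, inner ℝ u z = 0 → inner ℝ u (coneProj K z) = 0) {z : E m}
    (hz : 0 ≤ inner ℝ u z) : inner ℝ u (coneProj K z) ∈ Set.Icc 0 (inner ℝ u z) := by
  rcases hz.eq_or_lt with hz | hz
  · rw [h z hz.symm, ← hz]; simp
  have hn : 0 < ‖u‖ ^ 2 := by positivity
  set t := inner ℝ u z / ‖u‖ ^ 2 with ht
  have ht0 : 0 < t := by positivity
  have htu : t * ‖u‖ ^ 2 = inner ℝ u z := by rw [ht]; field_simp
  set w := z - t • u with hw
  have hzw : z - w = t • u := by rw [hw]; abel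
  have hw0 : inner ℝ u w = 0 := by
    rw [hw, inner_sub_right, inner_smul_right, real_inner_self_eq_norm_sq, htu, sub_self]
  have h1 := norm_coneProj_sub_sq_le K z w
  have h2 := norm_coneProj_sub_le K z w
  have h3 : inner ℝ (coneProj K z - coneProj K w) (z - w) = t * inner ℝ u (coneProj K z) := by
    rw [hzw, inner_smul_right, real_inner_comm, inner_sub_right, h w hw0, sub_zero]
  have h4 := real_inner_le_norm (coneProj K z - coneProj K w) (z - w)
  have h5 : ‖z - w‖ ^ 2 = t * inner ℝ u z := by
    rw [hzw, norm_smul, mul_pow, ← htu, Real.norm_eq_abs, sq_abs]; ring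
  rw [h3] at h1 h4
  constructor
  · exact nonneg_of_mul_nonneg_right ((sq_nonneg _).trans h1) ht0
  · refine le_of_mul_le_mul_left ?_ ht0
    rw [← h5, sq]
    exact h4.trans (mul_le_mul_of_nonneg_right h2 (norm_nonneg _))

theorem IsInvariant.lowerHalfspace {K : ProperCone ℝ (E m)} {u a : E m} (hu : u ≠ 0)
    (h : IsInvariant K (hyperplane u a)) : IsInvariant K (lowerHalfspace u a) := by
  rw [isInvariant_hyperplane_iff] at h
  rw [isInvariant_iff]
  intro x hx y hy
  simp only [LatticeLike.lowerHalfspace, Set.mem_ofPred_eq] at hx hy ⊢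
  rw [inner_add_right, inner_sub_right]
  -- The mirror estimate, from the normal `-u`.
  have hneg : ∀ z, inner ℝ u z ≤ 0 →
      inner ℝ u z ≤ inner ℝ u (coneProj K z) ∧ inner ℝ u (coneProj K z) ≤ 0 := by
    intro z hz
    have := inner_coneProj_mem_Icc K (neg_ne_zero.2 hu)
      (fun w hw => by simpa using h w (by simpa using hw)) (z := z) (by simpa using hz)
    simpa [and_comm] using this
  rcases le_total (inner ℝ u x) (inner ℝ u y) with hxy | hxy
  · have h1 := inner_coneProj_mem_Icc K hu h (z := y - x) (by rw [inner_sub_right]; linarith)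
    have h2 := hneg (x - y) (by rw [inner_sub_right]; linarith)
    rw [inner_sub_right] at h1 h2
    exact ⟨by linarith [h1.2], by linarith [h2.1]⟩
  · have h1 := inner_coneProj_mem_Icc K hu h (z := x - y) (by rw [inner_sub_right]; linarith)
    have h2 := hneg (y - x) (by rw [inner_sub_right]; linarith)
    rw [inner_sub_right] at h1 h2
    exact ⟨by linarith [h2.2], by linarith [h1.1]⟩

end ConeProj

/-! ### Supporting and tangent hyperplanes. -/

section Support

variable {C : Set (E m)}

theorem inner_lt_of_mem_interior {u x y : E m} (hu : u ≠ 0) (hC : C ⊆ lowerHalfspace u x)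
    (hy : y ∈ interior C) : inner ℝ u y < inner ℝ u x := by
  obtain ⟨ε, hε, hb⟩ := Metric.isOpen_iff.1 isOpen_interior y hy
  have hn : 0 < ‖u‖ := norm_pos_iff.2 hu
  have hmem : y + (ε / 2 / ‖u‖) • u ∈ ball y ε := by
    rw [mem_ball, dist_eq_norm, add_sub_cancel_left, norm_smul, Real.norm_of_nonneg (by positivity),
      div_mul_cancel₀ _ hn.ne']
    linarith
  have h : inner ℝ u (y + (ε / 2 / ‖u‖) • u) ≤ inner ℝ u x := hC (interior_subset (hb hmem))
  rw [inner_add_right, inner_smul_right, real_inner_self_eq_norm_sq] at h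
  have : 0 < ε / 2 / ‖u‖ * ‖u‖ ^ 2 := by positivity
  linarith

/-- A convex set `S` meeting the closed convex set `C` in `x` and missing the interior of `C`
is separated from `C` by a supporting hyperplane at `x`. -/
theorem exists_support_of_disjoint (hconvex : Convex ℝ C) (hint : (interior C).Nonempty)
    {S : Set (E m)} (hS : Convex ℝ S) (hd : Disjoint (interior C) S) {x : E m} (hxC : x ∈ C)
    (hxS : x ∈ S) :
    ∃ v : E m, v ≠ 0 ∧ C ⊆ lowerHalfspace v x ∧ ∀ s ∈ S, inner ℝ v x ≤ inner ℝ v s := by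
  obtain ⟨f, c, h1, h2⟩ :=
    geometric_hahn_banach_open hconvex.interior isOpen_interior hS hd
  have hle : ∀ y ∈ C, f y ≤ c := by
    intro y hy
    have hy' : y ∈ closure (interior C) := by
      rw [hconvex.closure_interior_eq_closure_of_nonempty_interior hint]
      exact subset_closure hy
    exact closure_minimal (fun z hz => (h1 z hz).le) (isClosed_le f.continuous continuous_const) hy'
  have hx : f x = c := le_antisymm (hle x hxC) (h2 x hxS)
  have hf : ∀ y, inner ℝ ((InnerProductSpace.toDual ℝ (E m)).symm f) y = f y := fun y =>
    InnerProductSpace.toDual_symm_apply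
  refine ⟨(InnerProductSpace.toDual ℝ (E m)).symm f, ?_, fun y hy => ?_, fun s hs => ?_⟩
  · intro h0
    obtain ⟨y, hy⟩ := hint
    have h3 := hf y
    have h4 := hf x
    rw [h0, inner_zero_left] at h3 h4
    linarith [h1 y hy]
  · simp only [lowerHalfspace, Set.mem_ofPred_eq, hf, hx]
    exact hle y hy
  · rw [hf, hf, hx]
    exact h2 s hs

/-- If `hyperplane u x` is the unique supporting hyperplane at `x`, then the tangent cone at `x`
contains the open halfspace. -/
theorem exists_pos_add_smul_mem (hconvex : Convex ℝ C) (hint : (interior C).Nonempty)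
    {u x w : E m} (hu : u ≠ 0) (hx : x ∈ C) (hC : C ⊆ lowerHalfspace u x)
    (huniq : ∀ H', IsSupportingAt C H' x → H' = hyperplane u x) (hw : inner ℝ u w < 0) :
    ∃ ε > (0 : ℝ), x + ε • w ∈ C := by
  by_contra! hcon
  have hxi : x ∉ interior C := fun h => (inner_lt_of_mem_interior hu hC h).ne rfl
  -- If the open ray from `x` along `w` misses `C`, the closed ray can be separated from `C` at `x`.
  obtain ⟨v, hv, hCv, hS⟩ := exists_support_of_disjoint (S := (fun ε : ℝ => x + ε • w) '' Set.Ici 0)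
    hconvex hint
    (by
      rintro _ ⟨s, hs, rfl⟩ _ ⟨t, ht, rfl⟩ a b ha hb hab
      refine ⟨a * s + b * t, add_nonneg (mul_nonneg ha hs) (mul_nonneg hb ht), ?_⟩
      simp only [smul_add, add_smul, smul_smul]
      nth_rewrite 1 [← one_smul ℝ x]
      rw [← hab, add_smul]
      abel)
    (by
      rw [Set.disjoint_left]
      rintro _ hy ⟨t, ht, rfl⟩
      rcases (Set.mem_Ici.1 ht).eq_or_lt with rfl | ht
      · exact hxi (by simpa using hy)
      · exact hcon t ht (interior_subset hy))
    hx ⟨0, by simp, by simp⟩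
  have hvw : 0 ≤ inner ℝ v w := by
    have := hS _ ⟨1, by simp, rfl⟩
    simpa [inner_add_right] using this
  have hH := huniq _ ⟨hx, v, hv, rfl, hCv⟩
  obtain ⟨p, hp⟩ := hint
  have hpu := inner_lt_of_mem_interior hu hC hp
  have hpv := inner_lt_of_mem_interior hv hCv hp
  -- By uniqueness `u` and `v` have the same orthogonal complement. The combination `α • w - β • (p
  -- - x)` is orthogonal to `u`, but its product with `v` is negative.
  set α := inner ℝ u (p - x) with hα
  set β := inner ℝ u w with hβ
  have hα0 : α < 0 := by rw [hα, inner_sub_right]; linarith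
  have hmem : x + (α • w - β • (p - x)) ∈ hyperplane u x := by
    simp only [hyperplane, Set.mem_ofPred_eq, inner_add_right]
    rw [inner_sub_right, inner_smul_right, inner_smul_right, ← hα, ← hβ]
    ring
  rw [← hH] at hmem
  simp only [hyperplane, Set.mem_ofPred_eq, inner_add_right] at hmem
  rw [inner_sub_right, inner_smul_right, inner_smul_right, inner_sub_right] at hmem
  nlinarith [mul_pos_of_neg_of_neg hw (sub_neg.2 hpv)]

theorem IsTangent.isInvariant {K : ProperCone ℝ (E m)} (hconvex : Convex ℝ C)
    (hint : (interior C).Nonempty) (hinv : IsInvariant K C) {H : Set (E m)}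
    (hH : IsTangent C H) : IsInvariant K H := by
  obtain ⟨x, ⟨hx, u, hu, rfl, hC⟩, huniq⟩ := hH
  rw [isInvariant_hyperplane_iff]
  rw [isInvariant_iff] at hinv
  intro z hz
  have hun : 0 < ‖u‖ ^ 2 := by positivity
  have hcont : ∀ s : ℝ, Tendsto (fun δ : ℝ => inner ℝ u (coneProj K (z + (s * δ) • u))) (𝓝[>] 0)
      (𝓝 (inner ℝ u (coneProj K z))) := by
    intro s
    have hc : Continuous fun δ : ℝ => inner ℝ u (coneProj K (z + (s * δ) • u)) :=
      continuous_const.inner ((continuous_coneProj K).comp (by fun_prop))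
    simpa using (hc.tendsto 0).mono_left nhdsWithin_le_nhds
  apply le_antisymm
  · refine le_of_tendsto (hcont (-1)) ?_
    filter_upwards [self_mem_nhdsWithin] with δ (hδ : 0 < δ)
    -- Tilting `z` by `-δ • u` puts it in the open halfspace; homogeneity then cancels `ε`.
    obtain ⟨ε, hε, hmem⟩ := exists_pos_add_smul_mem hconvex hint hu hx hC huniq
      (w := z + (-1 * δ) • u) (by
        rw [inner_add_right, inner_smul_right, hz, real_inner_self_eq_norm_sq]
        nlinarith)
    have h : inner ℝ u _ ≤ inner ℝ u x := hC (hinv x hx _ hmem).1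
    rw [add_sub_cancel_left, coneProj_smul K hε, inner_add_right, inner_smul_right] at h
    by_contra! hcon
    linarith [mul_pos hε hcon]
  · refine ge_of_tendsto (hcont 1) ?_
    filter_upwards [self_mem_nhdsWithin] with δ (hδ : 0 < δ)
    obtain ⟨ε, hε, hmem⟩ := exists_pos_add_smul_mem hconvex hint hu hx hC huniq
      (w := -(z + (1 * δ) • u)) (by
        rw [inner_neg_right, inner_add_right, inner_smul_right, hz, real_inner_self_eq_norm_sq]
        nlinarith)
    have h : inner ℝ u _ ≤ inner ℝ u x := hC (hinv x hx _ hmem).2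
    rw [sub_add_cancel_left, smul_neg, neg_neg, coneProj_smul K hε, inner_sub_right,
      inner_smul_right] at h
    by_contra! hcon
    linarith [mul_neg_of_pos_of_neg hε hcon]

/-- A supporting hyperplane at a point of a ball contained in `C` is orthogonal to the radius. -/
theorem smul_sub_eq_of_closedBall_subset {c v x : E m} {r : ℝ} (hr : 0 < r) (hv : v ≠ 0)
    (hball : closedBall c r ⊆ C) (hC : C ⊆ lowerHalfspace v x) (hx : x ∈ closedBall c r) :
    x - c = (r / ‖v‖) • v := by
  have hn : 0 < ‖v‖ := norm_pos_iff.2 hv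
  have hw : ‖(r / ‖v‖) • v‖ = r := by
    rw [norm_smul, Real.norm_of_nonneg (by positivity), div_mul_cancel₀ _ hn.ne']
  have hmem : c + (r / ‖v‖) • v ∈ closedBall c r := by
    rw [mem_closedBall, dist_eq_norm, add_sub_cancel_left, hw]
  have h : inner ℝ v (c + (r / ‖v‖) • v) ≤ inner ℝ v x := hC (hball hmem)
  have hxc : ‖x - c‖ ≤ r := by rwa [mem_closedBall, dist_eq_norm] at hx
  have hxc2 : ‖x - c‖ ^ 2 ≤ r ^ 2 := pow_le_pow_left₀ (norm_nonneg _) hxc 2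
  have h1 : r * ‖v‖ ≤ inner ℝ v (x - c) := by
    rw [inner_add_right, inner_smul_right, real_inner_self_eq_norm_sq] at h
    rw [inner_sub_right]
    have : r / ‖v‖ * ‖v‖ ^ 2 = r * ‖v‖ := by field_simp
    linarith
  have h2 : r ^ 2 ≤ inner ℝ (x - c) ((r / ‖v‖) • v) := by
    rw [inner_smul_right, real_inner_comm]
    calc r ^ 2 = r / ‖v‖ * (r * ‖v‖) := by field_simp
      _ ≤ _ := mul_le_mul_of_nonneg_left h1 (by positivity)
  -- Equality case of Cauchy–Schwarz: both vectors have norm at most `r` and inner product at least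
  -- `r ^ 2`.
  have h3 := norm_sub_sq_real (x - c) ((r / ‖v‖) • v)
  rw [hw] at h3
  have h4 : ‖x - c - (r / ‖v‖) • v‖ ^ 2 = 0 := le_antisymm (by linarith) (sq_nonneg _)
  exact sub_eq_zero.1 (norm_eq_zero.1 (pow_eq_zero_iff two_ne_zero |>.1 h4))

theorem hyperplane_smul {t : ℝ} (ht : t ≠ 0) (u a : E m) :
    hyperplane (t • u) a = hyperplane u a := by
  ext y
  simp [hyperplane, inner_smul_left, ht]

/-- At a boundary point lying on a ball contained in `C`, the supporting hyperplane is unique. -/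
theorem isTangent_of_closedBall_subset (hconvex : Convex ℝ C) (hint : (interior C).Nonempty)
    {c x : E m} {r : ℝ} (hr : 0 < r) (hball : closedBall c r ⊆ C) (hx : x ∈ closedBall c r)
    (hxi : x ∉ interior C) :
    ‖x - c‖ = r ∧ C ⊆ lowerHalfspace (x - c) x ∧ IsTangent C (hyperplane (x - c) x) := by
  obtain ⟨v, hv, hC, -⟩ := exists_support_of_disjoint (S := {x}) hconvex hint
    (convex_singleton x) (Set.disjoint_singleton_right.2 hxi) (hball hx) rfl
  have key : ∀ v, v ≠ 0 → C ⊆ lowerHalfspace v x → hyperplane v x = hyperplane (x - c) x := by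
    intro v hv hC
    rw [smul_sub_eq_of_closedBall_subset hr hv hball hC hx, hyperplane_smul]
    have := norm_pos_iff.2 hv
    positivity
  have hn : 0 < ‖v‖ := norm_pos_iff.2 hv
  have hxc := smul_sub_eq_of_closedBall_subset hr hv hball hC hx
  refine ⟨?_, fun y hy => ?_, x, ⟨hball hx, v, hv, (key v hv hC).symm, hC⟩, ?_⟩
  · rw [hxc, norm_smul, Real.norm_of_nonneg (by positivity), div_mul_cancel₀ _ hn.ne']
  · have h : inner ℝ v y ≤ inner ℝ v x := hC hy
    simp only [lowerHalfspace, Set.mem_ofPred_eq, hxc, real_inner_smul_left]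
    exact mul_le_mul_of_nonneg_left h (by positivity)
  · rintro _ ⟨-, v', hv', rfl, hC'⟩
    exact key v' hv' hC'

/-- Every point outside `C` is separated from `C` by a tangent hyperplane: move a small ball
inside `C` towards the point until it touches the boundary. -/
theorem exists_isTangent_separating (hclosed : IsClosed C) (hconvex : Convex ℝ C)
    (hint : (interior C).Nonempty) {y : E m} (hy : y ∉ C) :
    ∃ u a : E m, u ≠ 0 ∧ IsTangent C (hyperplane u a) ∧ C ⊆ lowerHalfspace u a ∧
      y ∉ lowerHalfspace u a := by
  obtain ⟨p, hp⟩ := hint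
  obtain ⟨R, hR, hRC⟩ := Metric.nhds_basis_closedBall.mem_iff.1 (mem_interior_iff_mem_nhds.1 hp)
  obtain ⟨d, hd, hdC⟩ := Metric.nhds_basis_ball.mem_iff.1 (hclosed.isOpen_compl.mem_nhds hy)
  have hpy : 0 < ‖y - p‖ :=
    norm_pos_iff.2 (sub_ne_zero.2 fun h => hy (h ▸ interior_subset hp))
  -- The first bound leaves room around `p`; the second ensures that the hyperplane touched by the
  -- ball passes strictly before `y`.
  obtain ⟨r, hr, hr1, hr2⟩ : ∃ r : ℝ, 0 < r ∧ r < R / 2 ∧ r < d / ‖y - p‖ * (R / 2) := by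
    obtain ⟨r, hr, hr'⟩ := exists_between (lt_min (half_pos hR)
      (mul_pos (div_pos hd hpy) (half_pos hR)))
    exact ⟨r, hr, hr'.trans_le (min_le_left _ _), hr'.trans_le (min_le_right _ _)⟩
  let c : ℝ → E m := fun t => p + t • (y - p)
  have hc : Continuous c := by fun_prop
  have hT : IsClosed {t : ℝ | closedBall (c t) r ⊆ C} := by
    have : {t : ℝ | closedBall (c t) r ⊆ C} = ⋂ b ∈ closedBall (0 : E m) r, {t | c t + b ∈ C} := by
      ext t
      simp only [Set.mem_ofPred_eq, Set.mem_iInter, Set.subset_def]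
      refine ⟨fun h b hb => h _ (by simpa using hb), fun h z hz => ?_⟩
      simpa using h (z - c t) (by simpa [dist_eq_norm] using hz)
    rw [this]
    exact isClosed_biInter fun b _ => hclosed.preimage (hc.add continuous_const)
  -- The last position on the segment from `p` to `y` at which the ball lies in `C`.
  obtain ⟨t, ⟨⟨ht0, ht1⟩, htC⟩, hmax⟩ :=
    (isCompact_Icc.inter_right hT : IsCompact (Set.Icc (0 : ℝ) 1 ∩ _)).exists_isGreatest
      ⟨0, ⟨le_rfl, zero_le_one⟩, by
        have : c 0 = p := by simp [c]
        simp only [Set.mem_ofPred_eq, this]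
        exact (closedBall_subset_closedBall (by linarith)).trans hRC⟩
  have htC : closedBall (c t) r ⊆ C := htC
  have hyc : y - c t = (1 - t) • (y - p) := by simp only [c, sub_smul, one_smul]; abel
  have hcp : c t - p = t • (y - p) := by simp [c]
  have hdist : d ≤ (1 - t) * ‖y - p‖ := by
    rw [← abs_of_nonneg (sub_nonneg.2 ht1), ← Real.norm_eq_abs, ← norm_smul, ← hyc, ← dist_eq_norm,
      dist_comm]
    by_contra! hcon
    exact hdC (mem_ball.2 hcon) (htC (mem_closedBall_self hr.le))
  have ht1 : t < 1 := by
    by_contra! h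
    nlinarith
  obtain ⟨x, hx, hxi⟩ : ∃ x ∈ closedBall (c t) r, x ∉ interior C := by
    by_contra! hcon
    -- A compact ball inside the open interior could be slid further, against maximality of `t`.
    obtain ⟨δ, hδ, hsub⟩ := (isCompact_closedBall (c t) r).exists_thickening_subset_open
      isOpen_interior hcon
    obtain ⟨s, hs0, hs⟩ := exists_between (lt_min (sub_pos.2 ht1) (div_pos hδ hpy))
    have hs1 := hs.trans_le (min_le_left _ _)
    have hs2 := (lt_div_iff₀ hpy).1 (hs.trans_le (min_le_right _ _))
    have : t + s ≤ t := hmax ⟨⟨by linarith, by linarith⟩, fun z hz => by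
      refine interior_subset (hsub (mem_thickening_iff.2 ⟨z - s • (y - p), ?_, ?_⟩))
      · rw [mem_closedBall, dist_eq_norm] at hz ⊢
        convert hz using 2
        simp only [c, add_smul]
        abel
      · rw [dist_eq_norm, sub_sub_cancel, norm_smul, Real.norm_of_nonneg hs0.le]
        exact hs2⟩
    linarith
  obtain ⟨hnorm, hC, htan⟩ := isTangent_of_closedBall_subset hconvex ⟨p, hp⟩ hr htC hx hxi
  refine ⟨x - c t, x, fun h => by simp [h] at hnorm; linarith, htan, hC, ?_⟩
  set u := x - c t with hu
  have hxu : inner ℝ u x = inner ℝ u (c t) + r ^ 2 := by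
    rw [← hnorm, ← real_inner_self_eq_norm_sq, ← inner_add_right]
    congr 1
    rw [hu]; abel
  -- The extreme point of the large ball in direction `u` gives `t * ⟪u, y - p⟫ ≥ r * (R - r) > r *
  -- (R / 2)`. Hence `⟪u, y - c t⟫ > (1 - t) * r * (R / 2) > r ^ 2`, which puts `y` beyond the
  -- hyperplane.
  have h1 : inner ℝ u (p + (R / r) • u) ≤ inner ℝ u x := hC (hRC (by
    rw [mem_closedBall, dist_eq_norm, add_sub_cancel_left, norm_smul, hnorm,
      Real.norm_of_nonneg (by positivity), div_mul_cancel₀ _ hr.ne']))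
  rw [inner_add_right, inner_smul_right, real_inner_self_eq_norm_sq, hnorm, hxu] at h1
  have h2 : R / r * r ^ 2 = R * r := by field_simp
  have h3 : inner ℝ u (c t) - inner ℝ u p = t * inner ℝ u (y - p) := by
    rw [← inner_sub_right, hcp, inner_smul_right]
  have h4 : inner ℝ u y - inner ℝ u (c t) = (1 - t) * inner ℝ u (y - p) := by
    rw [← inner_sub_right, hyc, inner_smul_right]
  have h5 : r * (R / 2) < inner ℝ u (y - p) := by
    have h6 : r * (R / 2) < t * inner ℝ u (y - p) := by nlinarith
    have h7 : 0 < inner ℝ u (y - p) := by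
      by_contra! h
      nlinarith [mul_nonpos_of_nonneg_of_nonpos ht0 h, mul_pos hr hR]
    nlinarith
  have h6 : r < (1 - t) * (R / 2) :=
    hr2.trans_le (mul_le_mul_of_nonneg_right ((div_le_iff₀ hpy).2 hdist) (by linarith))
  simp only [lowerHalfspace, Set.mem_ofPred_eq, not_le, hxu]
  nlinarith [mul_lt_mul_of_pos_left h5 (sub_pos.2 ht1), mul_lt_mul_of_pos_left h6 hr]

/-- A closed convex set with nonempty interior is a countable intersection of closed halfspaces
bounded by tangent hyperplanes. -/
theorem exists_countable_tangent_halfspaces (hclosed : IsClosed C) (hconvex : Convex ℝ C)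
    (hint : (interior C).Nonempty) :
    ∃ (I : Set ℕ) (u a : ℕ → E m),
      (∀ i ∈ I, u i ≠ 0 ∧ IsTangent C (hyperplane (u i) (a i))) ∧
      C = ⋂ i ∈ I, lowerHalfspace (u i) (a i) := by
  let S : Set (E m × E m) :=
    {q | q.1 ≠ 0 ∧ IsTangent C (hyperplane q.1 q.2) ∧ C ⊆ lowerHalfspace q.1 q.2}
  -- Lindelöf: countably many of the open complementary halfspaces already cover the complement of
  -- `C`.
  obtain ⟨T, hTc, hT⟩ := TopologicalSpace.isOpen_iUnion_countable
    (fun q : S => (lowerHalfspace q.1.1 q.1.2)ᶜ) fun q =>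
      (isClosed_le (continuous_const.inner continuous_id) continuous_const).isOpen_compl
  have hCT : C = ⋂ q ∈ T, lowerHalfspace q.1.1 q.1.2 := by
    refine Set.Subset.antisymm (Set.subset_iInter₂ fun q _ => q.2.2.2) fun y hy => ?_
    by_contra hyC
    obtain ⟨u, a, hu, htan, hC, hya⟩ := exists_isTangent_separating hclosed hconvex hint hyC
    have hmem : y ∈ ⋃ q : S, (lowerHalfspace q.1.1 q.1.2)ᶜ :=
      Set.mem_iUnion.2 ⟨⟨(u, a), hu, htan, hC⟩, hya⟩
    rw [← hT] at hmem
    obtain ⟨q, hq, hyq⟩ := Set.mem_iUnion₂.1 hmem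
    exact hyq (Set.mem_iInter₂.1 hy q hq)
  rcases T.eq_empty_or_nonempty with rfl | hne
  · exact ⟨∅, 0, 0, by simp, by simpa using hCT⟩
  · obtain ⟨f, rfl⟩ := hTc.exists_eq_range hne
    refine ⟨Set.univ, fun i => (f i).1.1, fun i => (f i).1.2,
      fun i _ => ⟨(f i).2.1, (f i).2.2.1⟩, ?_⟩
    simpa using hCT

end Support

end LatticeLike

theorem theorem2 (m : ℕ) (K : ProperCone ℝ (LatticeLike.E m)) (C : Set (LatticeLike.E m))
    (hclosed : IsClosed C) (hconvex : Convex ℝ C) (hint : (interior C).Nonempty) :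
    LatticeLike.IsInvariant K C ↔
      ∃ (I : Set ℕ) (u a : ℕ → LatticeLike.E m),
        (∀ i ∈ I, u i ≠ 0 ∧
          LatticeLike.IsTangent C (LatticeLike.hyperplane (u i) (a i)) ∧
          LatticeLike.IsInvariant K (LatticeLike.hyperplane (u i) (a i))) ∧
        C = ⋂ i ∈ I, LatticeLike.lowerHalfspace (u i) (a i) := by
  constructor
  · intro hinv
    obtain ⟨I, u, a, h, hC⟩ :=
      LatticeLike.exists_countable_tangent_halfspaces hclosed hconvex hint
    exact ⟨I, u, a,
      fun i hi => ⟨(h i hi).1, (h i hi).2, (h i hi).2.isInvariant hconvex hint hinv⟩, hC⟩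
  · rintro ⟨I, u, a, h, hC⟩
    have hi : ∀ i ∈ I, LatticeLike.IsInvariant K (LatticeLike.lowerHalfspace (u i) (a i)) :=
      fun i hi => (h i hi).2.2.lowerHalfspace (h i hi).1
    rw [LatticeLike.isInvariant_iff]
    intro x hx y hy
    rw [hC, Set.mem_iInter₂] at hx hy
    rw [hC, Set.mem_iInter₂, Set.mem_iInter₂]
    have key := fun i hiI =>
      (LatticeLike.isInvariant_iff K).1 (hi i hiI) x (hx i hiI) y (hy i hiI)
    exact ⟨fun i hiI => (key i hiI).1, fun i hiI => (key i hiI).2⟩
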